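/- Let $n_x,n_u\ge 1$ be integers, $f:\mathbb R^{n_x}\times\mathbb R^{n_u}\to\mathbb R^{n_x}$, $\ell:\mathbb R^{n_x}\times\mathbb R^{n_u}\to[0,\infty)$, and let $\mathcal U(x)\subseteq\mathbb R^{n_u}$ be a non-empty set of admissible inputs for each $x\in\mathbb R^{n_x}$. For an input sequence $\mathbf u=(u(0),u(1),\dots)$ let $x(0)=x$, $x(k+1)=f(x(k),u(k))$; $\mathbf u$ is admissible from $x$ if $u(k)\in\mathcal U(x(k))$ for all $k$, and $J(x,\mathbf u)=\sum_{k\ge 0}\ell(x(k),u(k))\in[0,\infty]$. Put $V^\star(x)=\inf J(x,\mathbf u)$ over the sequences $\mathbf u$ admissible from $x$. For a feedback law $h:\mathbb R^{n_x}\to\mathbb R^{n_u}$ let $J(x,h)$ be the cost from $x$ of the inputs $u(k)=h(x(k))$. A selection of a set-valued map $S$ is a map $h$ with $h(x)\in S(x)$ for every $x\in\mathbb R^{n_x}$. A class-$\mathcal K_\infty$ function is a continuous, strictly increasing, unbounded map $[0,\infty)\to[0,\infty)$ that vanishes at $0$. Let $h^0$ be a selection of $\mathcal U$. The algorithm PI$^+$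 defines $V_r^0(x)=J(x,h^0)$ and, for $i\ge 0$ and all $x$, $$H^{i+1}(x)=\operatorname*{arg\,min}_{u\in\mathcal U(x)}\{\ell(x,u)+V_r^i(f(x,u))\},\qquad H_r^{i+1}(x)=\bigcap_{\delta>0}\overline{H^{i+1}(x+\delta\mathbb B)},$$ $$V_r^{i+1}(x)=\min\{J(x,h): h \text{ a selection of } H_r^{i+1}\},$$ where $\mathbb B$ is the closed unit ball of $\mathbb R^{n_x}$ (before the minima are known to exist, read $\min$ as an infimum in $[0,\infty]$). Let $\sigma:\mathbb R^{n_x}\to[0,\infty)$ be continuous and assume: 1. for every $x$ there is a sequence $\mathbf u$ admissible from $x$ with $J(x,\mathbf u)=V^\star(x)<\infty$; 2. there are a continuous $W:\mathbb R^{n_x}\to[0,\infty)$, $\alpha_W,\chi_W\in\mathcal K_\infty$ and a continuous nondecreasing $\overline\alpha_W:[0,\infty)\to[0,\infty)$ with $\overline\alpha_W(0)=0$ such that for all $x$ and $u\in\mathcal U(x)$: $W(x)\le\overline\alpha_W(\sigma(x))$ and $W(f(x,u))-W(x)\le-\alpha_W(\sigma(x))+\chi_W(\ell(x,u))$; 3.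 there is $\overline\alpha_V\in\mathcal K_\infty$ with $J(x,h^0)\le\overline\alpha_V(\sigma(x))$ for all $x$; 4. (feasibility assumption) (i) $f$ and $\ell$ are continuous; (ii) $\ell$ is level-bounded in the admissible $u$, locally uniformly in $x$: for every $x$ and $a\in\mathbb R$ there are a neighbourhood $\mathcal S$ of $x$ and a bounded $B\subset\mathbb R^{n_u}$ with $\{u\in\mathcal U(z):\ell(z,u)\le a\}\subseteq B$ for all $z\in\mathcal S$; (iii) $\mathcal U$ is outer semicontinuous: $x_n\to x$, $u_n\in\mathcal U(x_n)$, $u_n\to u$ imply $u\in\mathcal U(x)$; (iv) $V_r^0$ is lower semicontinuous; (v) $\{x:\sigma(x)\le\Delta\}$ is compact for every $\Delta>0$. Then $V_r^i$ is well defined for every $i$, i.e. for all $i\ge0$ and all $x$ the set $H^{i+1}(x)$ is non-empty and the minimum defining $V_r^{i+1}(x)$ is attained, and $V^\star(x)\le V_r^i(x)<\infty$. Moreover, $V_r^i$ converges monotonically and compactly to $V^\star$: * (i) $V_r^{i+1}(x)\le V_r^i(x)$ for all $i\ge 0$ and all $x\in\mathbb R^{n_x}$; * (ii) for every compact $K\subset\mathbb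 R^{n_x}$ and every $\delta>0$ there is an integer $i^\star\ge1$ such that $V_r^i(x)-V^\star(x)\le\delta$ for all $x\in K$ and all $i\ge i^\star$. -/

import Mathlib

open Filter Topology
open scoped NNReal ENNReal

noncomputable section

namespace PIPlus

/-- Class `K∞` comparison functions on `[0, ∞)`. -/
def ClassKInf (α : ℝ≥0 → ℝ≥0) : Prop :=
  Continuous α ∧ StrictMono α ∧ α 0 = 0 ∧ Tendsto α atTop atTop

section Plant

variable {X U : Type*}

/-- The solution `φ(k, x, u)` of `x(k+1) = f(x(k), u(k))` started at `x`. -/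
def trajectory (f : X × U → X) (x : X) (u : ℕ → U) : ℕ → X
  | 0 => x
  | k + 1 => f (trajectory f x u k, u k)

/-- The input sequence `u` satisfies the state-dependent input constraint along the solution
that it generates from `x`. -/
def Admissible (f : X × U → X) (Uad : X → Set U) (x : X) (u : ℕ → U) : Prop :=
  ∀ k, u k ∈ Uad (trajectory f x u k)

/-- The infinite-horizon cost `J(x, u)` of an input sequence, with values in `[0, ∞]`. -/
def seqCost (f : X × U → X) (ℓ : X × U → ℝ≥0) (x : X) (u : ℕ → U) : ℝ≥0∞ :=
  ∑' k, (ℓ (trajectory f x u k, u k) : ℝ≥0∞)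

/-- The optimal value function `V⋆`. -/
def optValue (f : X × U → X) (ℓ : X × U → ℝ≥0) (Uad : X → Set U) (x : X) : ℝ≥0∞ :=
  ⨅ u ∈ {u : ℕ → U | Admissible f Uad x u}, seqCost f ℓ x u

/-- The solution `φ(k, x, h)` of the plant in closed loop with the feedback law `h`. -/
def closedLoop (f : X × U → X) (h : X → U) (x : X) : ℕ → X
  | 0 => x
  | k + 1 => f (closedLoop f h x k, h (closedLoop f h x k))

/-- The cost `J(x, h)` induced by the feedback law `h`. -/
def policyCost (f : X × U → X) (ℓ : X × U → ℝ≥0) (h : X → U) (x : X) : ℝ≥0∞ :=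
  ∑' k, (ℓ (closedLoop f h x k, h (closedLoop f h x k)) : ℝ≥0∞)

/-- The (everywhere defined) selections of the set-valued map `S`. -/
def selections (S : X → Set U) : Set (X → U) :=
  {h | ∀ x, h x ∈ S x}

/-- Improvement step: `x ↦ argmin_{u ∈ 𝒰(x)} { ℓ(x,u) + V(f(x,u)) }`. -/
def improve (f : X × U → X) (ℓ : X × U → ℝ≥0) (Uad : X → Set U) (V : X → ℝ≥0∞) (x : X) : Set U :=
  {u | u ∈ Uad x ∧ IsMinOn (fun v => (ℓ (x, v) : ℝ≥0∞) + V (f (x, v))) (Uad x) u}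

/-- Evaluation step: the smallest cost over all selections of `S`. It is an infimum in `[0, ∞]`
(equal to `∞` if there is no selection). -/
def evaluate (f : X × U → X) (ℓ : X × U → ℝ≥0) (S : X → Set U) (x : X) : ℝ≥0∞ :=
  ⨅ h ∈ selections S, policyCost f ℓ h x

/-- Regularization step: `x ↦ ⋂_{δ > 0} closure (S (x + δ 𝔹))`, `𝔹` the closed unit ball. -/
def regularize [PseudoMetricSpace X] [TopologicalSpace U] (S : X → Set U) (x : X) : Set U :=
  ⋂ (δ : ℝ) (_ : 0 < δ), closure (⋃ z ∈ Metric.closedBall x δ, S z)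

/-- The value functions `V_r^i` generated by PI⁺ from the initial policy `h₀`. -/
def value [PseudoMetricSpace X] [TopologicalSpace U] (f : X × U → X) (ℓ : X × U → ℝ≥0)
    (Uad : X → Set U) (h₀ : X → U) : ℕ → X → ℝ≥0∞
  | 0 => policyCost f ℓ h₀
  | i + 1 => evaluate f ℓ (regularize (improve f ℓ Uad (value f ℓ Uad h₀ i)))

/-- The set-valued maps `H^i` of PI⁺. -/
def inputs [PseudoMetricSpace X] [TopologicalSpace U] (f : X × U → X) (ℓ : X × U → ℝ≥0)
    (Uad : X → Set U) (h₀ : X → U) : ℕ → X → Set U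
  | 0 => fun x => {h₀ x}
  | i + 1 => improve f ℓ Uad (value f ℓ Uad h₀ i)

/-- The regularized set-valued maps `H_r^i` of PI⁺. -/
def regInputs [PseudoMetricSpace X] [TopologicalSpace U] (f : X × U → X) (ℓ : X × U → ℝ≥0)
    (Uad : X → Set U) (h₀ : X → U) : ℕ → X → Set U
  | 0 => fun x => {h₀ x}
  | i + 1 => regularize (inputs f ℓ Uad h₀ (i + 1))

/-- Every initial state has an optimal admissible input sequence, of finite cost. -/
def WellPosed (f : X × U → X) (ℓ : X × U → ℝ≥0) (Uad : X → Set U) : Prop :=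
  ∀ x, ∃ u, Admissible f Uad x u ∧ seqCost f ℓ x u = optValue f ℓ Uad x ∧
    optValue f ℓ Uad x < ⊤

/-- Detectability of the plant and the stage cost with respect to the state measure `σ`. -/
def Detectable [TopologicalSpace X] (f : X × U → X) (ℓ : X × U → ℝ≥0) (Uad : X → Set U)
    (σ : X → ℝ≥0) : Prop :=
  ∃ (W : X → ℝ≥0) (αW χW αWbar : ℝ≥0 → ℝ≥0),
    Continuous W ∧ ClassKInf αW ∧ ClassKInf χW ∧
    Continuous αWbar ∧ Monotone αWbar ∧ αWbar 0 = 0 ∧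
    ∀ x, ∀ u ∈ Uad x,
      W x ≤ αWbar (σ x) ∧
      (W (f (x, u)) : ℝ) - (W x : ℝ) ≤ -(αW (σ x) : ℝ) + (χW (ℓ (x, u)) : ℝ)

/-- The cost of the policy `h` is bounded by a class `K∞` function of `σ`. -/
def Stabilizing (f : X × U → X) (ℓ : X × U → ℝ≥0) (σ : X → ℝ≥0) (h : X → U) : Prop :=
  ∃ αV : ℝ≥0 → ℝ≥0, ClassKInf αV ∧ ∀ x, policyCost f ℓ h x ≤ (αV (σ x) : ℝ≥0∞)

/-- `ℓ` is level-bounded in the admissible inputs, locally uniformly in the state. This is implied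
by the same property with `{u | ℓ (z, u) ≤ a}` in place of `{u ∈ 𝒰(z) | ℓ (z, u) ≤ a}`. -/
def LevelBounded [TopologicalSpace X] [Bornology U] (ℓ : X × U → ℝ≥0) (Uad : X → Set U) : Prop :=
  ∀ (x : X) (a : ℝ), ∃ S ∈ 𝓝 x, ∃ B : Set U, Bornology.IsBounded B ∧
    ∀ z ∈ S, {u | u ∈ Uad z ∧ (ℓ (z, u) : ℝ) ≤ a} ⊆ B

/-- Outer semicontinuity of a set-valued map (between Euclidean spaces): limits of values along
convergent sequences of points belong to the value at the limit point. -/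
def OuterSemicontinuous [TopologicalSpace X] [TopologicalSpace U] (S : X → Set U) : Prop :=
  ∀ (x : X) (u : U) (xs : ℕ → X) (us : ℕ → U), Tendsto xs atTop (𝓝 x) →
    Tendsto us atTop (𝓝 u) → (∀ n, us n ∈ S (xs n)) → u ∈ S x

end Plant

end PIPlus

end

/-! Three properties pass from each `value` iterate to the next: lower semicontinuity, being the
cost of one admissible policy, and the bound `αV ∘ σ`. They make the argmin map nonempty and locally
contained in compact sets. Regularization closes its graph without leaving `Uad`, so evaluation
attains a lower semicontinuous minimum (`exists_selection_policyCost_eq_evaluate`).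

Selections of the argmin survive regularization, whence the Bellman inequality `V (i+1) x ≤ ℓ (x,u)
+ V i (f (x,u))` for all admissible `u`. It gives monotonicity and, iterated along an optimal
sequence, `V j x ≤ V⋆ x + V 0 (x(j))`. By detectability `σ (x(j))` is small for some `j` below a
bound uniform on compact sets, and there `V 0 ≤ αV ∘ σ` is small. -/

namespace PIPlus

/-! ### Set-valued maps: closed graphs and parametric minimization -/

section Optimization

variable {X U : Type*}

/-- Reduces regularization to graph closure: `δ` and the closure tolerance are the two radii of a
product neighbourhood. -/
theorem regularize_eq_closure_graph [PseudoMetricSpace X] [PseudoMetricSpace U]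
    (S : X → Set U) (x : X) :
    regularize S x = {u | (x, u) ∈ closure {p : X × U | p.2 ∈ S p.1}} := by
  ext u
  simp only [regularize, Set.mem_iInter, Set.mem_ofPred_eq, Metric.mem_closure_iff,
    Set.mem_iUnion, Metric.mem_closedBall]
  constructor
  · intro h ε hε
    obtain ⟨v, ⟨z, hz, hv⟩, huv⟩ := h (ε / 2) (half_pos hε) ε hε
    refine ⟨(z, v), hv, ?_⟩
    rw [Prod.dist_eq]
    refine max_lt ?_ huv
    rw [dist_comm]
    exact lt_of_le_of_lt hz (half_lt_self hε)
  · intro h δ hδ ε hε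
    obtain ⟨⟨z, v⟩, hv, hd⟩ := h (min δ ε) (lt_min hδ hε)
    rw [Prod.dist_eq, max_lt_iff] at hd
    refine ⟨v, ⟨z, ?_, hv⟩, hd.2.trans_le (min_le_right _ _)⟩
    rw [dist_comm]
    exact (hd.1.trans_le (min_le_left _ _)).le

theorem subset_regularize [PseudoMetricSpace X] [PseudoMetricSpace U] (S : X → Set U) (x : X) :
    S x ⊆ regularize S x := by
  rw [regularize_eq_closure_graph]
  exact fun u hu => subset_closure hu

theorem isClosed_graph_regularize [PseudoMetricSpace X] [PseudoMetricSpace U] (S : X → Set U) :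
    IsClosed {p : X × U | p.2 ∈ regularize S p.1} := by
  simp only [regularize_eq_closure_graph]
  exact isClosed_closure

theorem regularize_subset [PseudoMetricSpace X] [PseudoMetricSpace U] {S T : X → Set U}
    (hT : IsClosed {p : X × U | p.2 ∈ T p.1}) (hST : ∀ x, S x ⊆ T x) (x : X) :
    regularize S x ⊆ T x := by
  rw [regularize_eq_closure_graph]
  intro u hu
  exact closure_minimal (fun p hp => hST p.1 hp) hT hu

theorem OuterSemicontinuous.isClosed_graph [PseudoMetricSpace X] [PseudoMetricSpace U]
    {S : X → Set U} (hS : OuterSemicontinuous S) : IsClosed {p : X × U | p.2 ∈ S p.1} := by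
  refine IsSeqClosed.isClosed fun p q hp hpq => ?_
  exact hS q.1 q.2 (fun n => (p n).1) (fun n => (p n).2)
    ((continuous_fst.tendsto q).comp hpq) ((continuous_snd.tendsto q).comp hpq) hp

/-- Local boundedness of a set-valued map, in the form that its values are locally contained in a
compact set. -/
def LocallyInCompact [TopologicalSpace X] [TopologicalSpace U] (S : X → Set U) : Prop :=
  ∀ x, ∃ C : Set U, IsCompact C ∧ ∀ᶠ z in 𝓝 x, S z ⊆ C

/-- Near `z` the graph lies over the closed set `C`, hence so does its closure. -/
theorem LocallyInCompact.regularize [PseudoMetricSpace X] [MetricSpace U] {S : X → Set U}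
    (hS : LocallyInCompact S) : LocallyInCompact (regularize S) := by
  intro x
  obtain ⟨C, hC, hSC⟩ := hS x
  refine ⟨C, hC, ?_⟩
  filter_upwards [eventually_eventually_nhds.2 hSC] with z hz
  rw [regularize_eq_closure_graph]
  intro u hu
  rw [← hC.isClosed.closure_eq]
  refine mem_closure_iff_frequently.2 fun hn => ?_
  refine (mem_closure_iff_frequently.1 hu) ?_
  have h1 : ∀ᶠ p : X × U in 𝓝 (z, u), S p.1 ⊆ C := (continuous_fst.tendsto (z, u)).eventually hz
  have h2 : ∀ᶠ p : X × U in 𝓝 (z, u), ¬ p.2 ∈ C := (continuous_snd.tendsto (z, u)).eventually hn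
  filter_upwards [h1, h2] with p hp1 hp2 hp
  exact hp2 (hp1 hp)

theorem isClosed_of_isClosed_graph [TopologicalSpace X] [TopologicalSpace U] {S : X → Set U}
    (hS : IsClosed {p : X × U | p.2 ∈ S p.1}) (x : X) : IsClosed (S x) :=
  hS.preimage (Continuous.prodMk_right x)

theorem LocallyInCompact.isCompact [TopologicalSpace X] [TopologicalSpace U] {S : X → Set U}
    (hS : LocallyInCompact S) (hcl : IsClosed {p : X × U | p.2 ∈ S p.1}) (x : X) :
    IsCompact (S x) := by
  obtain ⟨C, hC, hSC⟩ := hS x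
  exact hC.of_isClosed_subset (isClosed_of_isClosed_graph hcl x) hSC.self_of_nhds

/-- Tube argument over the compact `C`: inputs outside `S x` are excluded nearby by the closed
graph, the others are handled by semicontinuity of `Q`. -/
theorem LocallyInCompact.lowerSemicontinuous_iInf [TopologicalSpace X] [TopologicalSpace U]
    {S : X → Set U} (hS : LocallyInCompact S) (hcl : IsClosed {p : X × U | p.2 ∈ S p.1})
    {Q : X × U → ℝ≥0∞} (hQ : LowerSemicontinuous Q) :
    LowerSemicontinuous fun x => ⨅ u ∈ S x, Q (x, u) := by
  intro x y hy
  -- A pointwise strict bound passes to the infimum only as `≤`; the gap `y < y'` restores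
  -- strictness.
  obtain ⟨y', hyy', hy'⟩ := exists_between hy
  obtain ⟨C, hC, hSC⟩ := hS x
  have key : ∀ u ∈ C, ∀ᶠ p : X × U in 𝓝 (x, u), p.2 ∈ S p.1 → y' < Q p := by
    intro u _
    by_cases hu : u ∈ S x
    · have : y' < Q (x, u) := hy'.trans_le (iInf₂_le u hu)
      filter_upwards [hQ (x, u) y' this] with p hp _ using hp
    · filter_upwards [hcl.isOpen_compl.mem_nhds (show (x, u) ∈ _ from hu)] with p hp hp'
      exact absurd hp' hp
  filter_upwards [hC.eventually_forall_of_forall_eventually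
    (P := fun z u => u ∈ S z → y' < Q (z, u)) key, hSC] with z hz hzC
  exact hyy'.trans_le (le_iInf₂ fun u hu => (hz u (hzC hu) hu).le)

end Optimization

/-! ### Policy costs, value iteration and the two steps of the algorithm -/

section Plant

variable {X U : Type*} {f : X × U → X} {ℓ : X × U → ℝ≥0}

theorem closedLoop_succ' (f : X × U → X) (h : X → U) (x : X) (k : ℕ) :
    closedLoop f h x (k + 1) = closedLoop f h (f (x, h x)) k := by
  induction k with
  | zero => rfl
  | succ k ih => rw [closedLoop, ih, closedLoop]

theorem policyCost_eq (f : X × U → X) (ℓ : X × U → ℝ≥0) (h : X → U) (x : X) :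
    policyCost f ℓ h x = ℓ (x, h x) + policyCost f ℓ h (f (x, h x)) := by
  rw [policyCost, tsum_eq_zero_add' ENNReal.summable, policyCost]
  simp only [closedLoop_succ']
  rfl

/-- A value function that dominates one step of the closed loop dominates the policy cost. -/
theorem policyCost_le {h : X → U} {V : X → ℝ≥0∞}
    (hV : ∀ x, (ℓ (x, h x) : ℝ≥0∞) + V (f (x, h x)) ≤ V x) (x : X) :
    policyCost f ℓ h x ≤ V x := by
  have key : ∀ n, ∑ k ∈ Finset.range n,
      (ℓ (closedLoop f h x k, h (closedLoop f h x k)) : ℝ≥0∞) + V (closedLoop f h x n) ≤ V x := by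
    intro n
    induction n with
    | zero => simp [closedLoop]
    | succ n ih =>
      rw [Finset.sum_range_succ, add_assoc]
      exact (add_le_add le_rfl (hV _)).trans ih
  rw [policyCost, ENNReal.tsum_eq_iSup_nat]
  exact iSup_le fun n => le_self_add.trans (key n)

theorem optValue_le_policyCost {Uad : X → Set U} {h : X → U} (hh : h ∈ selections Uad) (x : X) :
    optValue f ℓ Uad x ≤ policyCost f ℓ h x := by
  have htraj : ∀ k, trajectory f x (fun k => h (closedLoop f h x k)) k = closedLoop f h x k := by
    intro k
    induction k with
    | zero => rfl
    | succ k ih => rw [trajectory, ih, closedLoop]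
  refine (iInf₂_le (fun k => h (closedLoop f h x k)) ?_).trans_eq ?_
  · intro k
    rw [htraj]
    exact hh _
  · simp only [seqCost, htraj, policyCost]

/-- Value iteration from `0` over the inputs allowed by the set-valued map `S`. -/
noncomputable def finiteHorizon (f : X × U → X) (ℓ : X × U → ℝ≥0) (S : X → Set U) : ℕ → X → ℝ≥0∞
  | 0 => 0
  | n + 1 => fun x => ⨅ u ∈ S x, ((ℓ (x, u) : ℝ≥0∞) + finiteHorizon f ℓ S n (f (x, u)))

theorem finiteHorizon_monotone (f : X × U → X) (ℓ : X × U → ℝ≥0) (S : X → Set U) :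
    Monotone (finiteHorizon f ℓ S) := by
  refine monotone_nat_of_le_succ fun n => ?_
  induction n with
  | zero => exact fun x => zero_le
  | succ n ih => exact fun x => iInf₂_mono fun u _ => add_le_add le_rfl (ih _)

theorem finiteHorizon_le_policyCost {S : X → Set U} {h : X → U} (hh : h ∈ selections S) (n : ℕ)
    (x : X) : finiteHorizon f ℓ S n x ≤ policyCost f ℓ h x := by
  induction n generalizing x with
  | zero => exact zero_le
  | succ n ih =>
    rw [policyCost_eq]
    exact (iInf₂_le (h x) (hh x)).trans (add_le_add le_rfl (ih _))

theorem lowerSemicontinuous_stage [TopologicalSpace X] [TopologicalSpace U] (hf : Continuous f)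
    (hℓ : Continuous ℓ) {V : X → ℝ≥0∞} (hV : LowerSemicontinuous V) :
    LowerSemicontinuous fun p : X × U => (ℓ p : ℝ≥0∞) + V (f p) :=
  (ENNReal.continuous_coe.comp hℓ).lowerSemicontinuous.add (hV.comp hf)

section Evaluation

variable [TopologicalSpace X] [TopologicalSpace U]

theorem lowerSemicontinuous_finiteHorizon (hf : Continuous f) (hℓ : Continuous ℓ) {S : X → Set U}
    (hS : LocallyInCompact S) (hcl : IsClosed {p : X × U | p.2 ∈ S p.1}) (n : ℕ) :
    LowerSemicontinuous (finiteHorizon f ℓ S n) := by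
  induction n with
  | zero => exact lowerSemicontinuous_const
  | succ n ih => exact hS.lowerSemicontinuous_iInf hcl (lowerSemicontinuous_stage hf hℓ ih)

/-- Cantor intersection: the inputs whose `n`-step Bellman value is at most the supremum form nested
nonempty compact sets, and a common point works for all `n`. -/
theorem exists_bellman_iSup_finiteHorizon [T2Space U] (hf : Continuous f) (hℓ : Continuous ℓ)
    {S : X → Set U} (hne : ∀ x, (S x).Nonempty) (hS : LocallyInCompact S)
    (hcl : IsClosed {p : X × U | p.2 ∈ S p.1}) (x : X) :
    ∃ u ∈ S x, (ℓ (x, u) : ℝ≥0∞) + ⨆ n, finiteHorizon f ℓ S n (f (x, u)) ≤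
      ⨆ n, finiteHorizon f ℓ S n x := by
  have hSx := hS.isCompact hcl x
  have hQ : ∀ n, LowerSemicontinuous fun u =>
      (ℓ (x, u) : ℝ≥0∞) + finiteHorizon f ℓ S n (f (x, u)) := fun n =>
    (lowerSemicontinuous_stage hf hℓ (lowerSemicontinuous_finiteHorizon hf hℓ hS hcl n)).comp
      (Continuous.prodMk_right x)
  let A : ℕ → Set U := fun n => S x ∩
    {u | (ℓ (x, u) : ℝ≥0∞) + finiteHorizon f ℓ S n (f (x, u)) ≤ ⨆ n, finiteHorizon f ℓ S n x}
  have hAcl : ∀ n, IsClosed {u | (ℓ (x, u) : ℝ≥0∞) + finiteHorizon f ℓ S n (f (x, u)) ≤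
      ⨆ n, finiteHorizon f ℓ S n x} := fun n => (hQ n).isClosed_preimage _
  have hAc : ∀ n, IsCompact (A n) := fun n => hSx.inter_right (hAcl n)
  have hanti : Antitone A := fun m n hmn u hu =>
    ⟨hu.1, (add_le_add le_rfl (finiteHorizon_monotone f ℓ S hmn _)).trans hu.2⟩
  have hAne : ∀ n, (A n).Nonempty := by
    intro n
    obtain ⟨u, hu, hmin⟩ := ((hQ n).lowerSemicontinuousOn (S x)).exists_isMinOn (hne x) hSx
    refine ⟨u, hu, ?_⟩
    exact (le_iInf₂ fun v hv => hmin hv).trans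
      (le_iSup (fun n => finiteHorizon f ℓ S n x) (n + 1))
  obtain ⟨u, hu⟩ := IsCompact.nonempty_iInter_of_directed_nonempty_isCompact_isClosed A
    hanti.directed_ge hAne hAc fun n => (hAc n).isClosed
  rw [Set.mem_iInter] at hu
  refine ⟨u, (hu 0).1, ?_⟩
  rw [ENNReal.add_iSup]
  exact iSup_le fun n => (hu n).2

/-- The evaluation step over a locally bounded set-valued map with closed graph has a lower
semicontinuous value, which a single selection attains at every state. -/
theorem exists_selection_policyCost_eq_evaluate [T2Space U] (hf : Continuous f)
    (hℓ : Continuous ℓ) {S : X → Set U} (hne : ∀ x, (S x).Nonempty) (hS : LocallyInCompact S)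
    (hcl : IsClosed {p : X × U | p.2 ∈ S p.1}) :
    LowerSemicontinuous (evaluate f ℓ S) ∧
      ∃ h ∈ selections S, policyCost f ℓ h = evaluate f ℓ S := by
  choose h hh hV using exists_bellman_iSup_finiteHorizon hf hℓ hne hS hcl
  -- The cycle cost of `h` ≤ supremum ≤ `evaluate` ≤ cost of `h` forces equality.
  have h1 : ∀ x, policyCost f ℓ h x ≤ ⨆ n, finiteHorizon f ℓ S n x := policyCost_le hV
  have h2 : ∀ x, ⨆ n, finiteHorizon f ℓ S n x ≤ evaluate f ℓ S x := fun x =>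
    le_iInf₂ fun g hg => iSup_le fun n => finiteHorizon_le_policyCost hg n x
  have h3 : ∀ x, evaluate f ℓ S x ≤ policyCost f ℓ h x := fun x => iInf₂_le h hh
  refine ⟨?_, h, hh, funext fun x => ((h1 x).trans (h2 x)).antisymm (h3 x)⟩
  have : evaluate f ℓ S = fun x => ⨆ n, finiteHorizon f ℓ S n x :=
    funext fun x => ((h3 x).trans (h1 x)).antisymm (h2 x)
  rw [this]
  exact lowerSemicontinuous_iSup fun n => lowerSemicontinuous_finiteHorizon hf hℓ hS hcl n

end Evaluation

/-- `V` is non-increasing, up to the stage cost, along the closed loop of an admissible policy. -/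
def Decreasing (f : X × U → X) (ℓ : X × U → ℝ≥0) (Uad : X → Set U) (V : X → ℝ≥0∞) : Prop :=
  ∃ h ∈ selections Uad, ∀ x, (ℓ (x, h x) : ℝ≥0∞) + V (f (x, h x)) ≤ V x

theorem decreasing_policyCost {Uad : X → Set U} {h : X → U} (hh : h ∈ selections Uad) :
    Decreasing f ℓ Uad (policyCost f ℓ h) :=
  ⟨h, hh, fun x => (policyCost_eq f ℓ h x).ge⟩

theorem Decreasing.le_of_mem_improve {Uad : X → Set U} {V : X → ℝ≥0∞}
    (hV : Decreasing f ℓ Uad V) {x : X} {u : U} (hu : u ∈ improve f ℓ Uad V x) :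
    (ℓ (x, u) : ℝ≥0∞) + V (f (x, u)) ≤ V x := by
  obtain ⟨h, hh, hhV⟩ := hV
  exact (hu.2 (hh x)).trans (hhV x)

/-- A selection `g` of the argmin minimizes the first step, and its remaining cost is at most `V`
because `V` decreases along `g`. -/
theorem Decreasing.evaluate_le {Uad : X → Set U} {V : X → ℝ≥0∞} (hV : Decreasing f ℓ Uad V)
    (hne : ∀ x, (improve f ℓ Uad V x).Nonempty) {S : X → Set U}
    (hS : ∀ x, improve f ℓ Uad V x ⊆ S x) {x : X} {u : U} (hu : u ∈ Uad x) :
    evaluate f ℓ S x ≤ ℓ (x, u) + V (f (x, u)) := by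
  choose g hg using hne
  refine (iInf₂_le g fun z => hS z (hg z)).trans ?_
  rw [policyCost_eq]
  exact (add_le_add le_rfl (policyCost_le (fun z => hV.le_of_mem_improve (hg z)) _)).trans
    ((hg x).2 hu)

section Improvement

variable [MetricSpace X] [MetricSpace U] [ProperSpace U]

/-- An input with stage cost above `V x` cannot beat `h x`, so minimizing over a compact sublevel
set of `ℓ` suffices. -/
theorem improve_nonempty (hf : Continuous f) (hℓ : Continuous ℓ) {Uad : X → Set U}
    (hlevel : LevelBounded ℓ Uad) (hcl : IsClosed {p : X × U | p.2 ∈ Uad p.1})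
    {V : X → ℝ≥0∞} (hlsc : LowerSemicontinuous V) (hV : Decreasing f ℓ Uad V)
    {x : X} (hfin : V x ≠ ⊤) : (improve f ℓ Uad V x).Nonempty := by
  obtain ⟨h, hh, hhV⟩ := hV
  obtain ⟨T, hT, B, hB, hTB⟩ := hlevel x (V x).toReal
  have hsub := hTB x (mem_of_mem_nhds hT)
  have hle : ∀ u, (ℓ (x, u) : ℝ) ≤ (V x).toReal ↔ (ℓ (x, u) : ℝ≥0∞) ≤ V x := fun u =>
    (ENNReal.toReal_le_toReal (a := ℓ (x, u)) ENNReal.coe_ne_top hfin)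
  have hK : IsCompact {u | u ∈ Uad x ∧ (ℓ (x, u) : ℝ) ≤ (V x).toReal} := by
    refine Metric.isCompact_of_isClosed_isBounded ?_ (hB.subset hsub)
    exact (isClosed_of_isClosed_graph hcl x).inter
      (isClosed_le (NNReal.continuous_coe.comp (hℓ.comp (Continuous.prodMk_right x)))
        continuous_const)
  have hhx : h x ∈ {u | u ∈ Uad x ∧ (ℓ (x, u) : ℝ) ≤ (V x).toReal} :=
    ⟨hh x, (hle _).2 (le_self_add.trans (hhV x))⟩
  obtain ⟨u, hu, hmin⟩ := (((lowerSemicontinuous_stage hf hℓ hlsc).comp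
    (Continuous.prodMk_right x)).lowerSemicontinuousOn _).exists_isMinOn ⟨h x, hhx⟩ hK
  refine ⟨u, hu.1, fun v hv => ?_⟩
  by_cases hv' : (ℓ (x, v) : ℝ) ≤ (V x).toReal
  · exact hmin ⟨hv, hv'⟩
  · rw [hle, not_le] at hv'
    exact (hmin hhx).trans ((hhV x).trans (hv'.le.trans le_self_add))

/-- Minimizers have stage cost at most `V`; the continuous majorant `b` bounds this locally, which
semicontinuity of `V` would not. -/
theorem locallyInCompact_improve {Uad : X → Set U} (hlevel : LevelBounded ℓ Uad)
    {V : X → ℝ≥0∞} (hV : Decreasing f ℓ Uad V) {b : X → ℝ≥0} (hb : Continuous b)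
    (hVb : ∀ x, V x ≤ b x) : LocallyInCompact (improve f ℓ Uad V) := by
  intro x
  obtain ⟨T, hT, B, hB, hTB⟩ := hlevel x (b x + 1 : ℝ≥0)
  refine ⟨closure B, hB.isCompact_closure, ?_⟩
  have hlt : ∀ᶠ z in 𝓝 x, b z < b x + 1 :=
    hb.continuousAt.eventually_lt_const (lt_add_of_pos_right _ zero_lt_one)
  filter_upwards [hT, hlt] with z hz hbz u hu
  refine subset_closure (hTB z hz ⟨hu.1, ?_⟩)
  have h1 : (ℓ (z, u) : ℝ≥0∞) ≤ b z :=
    le_self_add.trans ((hV.le_of_mem_improve hu).trans (hVb z))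
  exact_mod_cast (ENNReal.coe_le_coe.1 h1).trans hbz.le

end Improvement

/-! ### Convergence estimates -/

/-- Along an admissible sequence, the `k`-th value function is bounded by the cost of `k` steps
plus the initial value function at the state then reached. -/
theorem le_sum_add_of_bellman_le {Uad : X → Set U} {V : ℕ → X → ℝ≥0∞}
    (hV : ∀ i x, ∀ u ∈ Uad x, V (i + 1) x ≤ ℓ (x, u) + V i (f (x, u)))
    {x : X} {u : ℕ → U} (hu : Admissible f Uad x u) (k j : ℕ) :
    V k (trajectory f x u j) ≤
      ∑ m ∈ Finset.range k, (ℓ (trajectory f x u (j + m), u (j + m)) : ℝ≥0∞) +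
        V 0 (trajectory f x u (j + k)) := by
  induction k generalizing j with
  | zero => simp
  | succ k ih =>
    refine (hV k _ _ (hu j)).trans ((add_le_add le_rfl (ih (j + 1))).trans_eq ?_)
    rw [Finset.sum_range_succ']
    simp only [add_zero, add_comm, add_left_comm]

/-- A class `K∞` function is bounded on bounded intervals by an affine function of arbitrarily
small value at `0`. -/
theorem ClassKInf.exists_affine_bound {χ : ℝ≥0 → ℝ≥0} (hχ : ClassKInf χ) {c : ℝ} (hc : 0 < c)
    (M : ℝ≥0) : ∃ L : ℝ, 0 ≤ L ∧ ∀ t ≤ M, (χ t : ℝ) ≤ c + L * t := by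
  obtain ⟨hcont, hmono, h0, -⟩ := hχ
  have hev : ∀ᶠ s in 𝓝 (0 : ℝ≥0), (χ s : ℝ) < c :=
    (NNReal.continuous_coe.comp hcont).continuousAt.eventually_lt_const (by simpa [h0] using hc)
  obtain ⟨s, hs, hpos⟩ :=
    ((hev.filter_mono nhdsWithin_le_nhds).and (self_mem_nhdsWithin (s := Set.Ioi (0 : ℝ≥0)))).exists
  have hs0 : (0 : ℝ) < s := hpos
  refine ⟨χ M / s, by positivity, fun t ht => ?_⟩
  rcases le_total t s with h | h
  · have h1 : (χ t : ℝ) ≤ χ s := hmono.monotone h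
    have h2 : (0 : ℝ) ≤ χ M / s * t := by positivity
    linarith
  · have h1 : (χ t : ℝ) ≤ χ M := hmono.monotone ht
    have h2 : (χ M : ℝ) ≤ χ M / s * t := by
      rw [div_mul_eq_mul_div, le_div_iff₀ hs0]
      exact mul_le_mul_of_nonneg_left h (χ M).2
    linarith

/-- Under detectability, admissible sequences of bounded cost that start in a sublevel set of `σ`
come close to the zero set of `σ` within a uniform time. -/
theorem Detectable.exists_time [TopologicalSpace X] {Uad : X → Set U} {σ : X → ℝ≥0}
    (hdet : Detectable f ℓ Uad σ) (Δ M : ℝ≥0) {η : ℝ≥0} (hη : 0 < η) :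
    ∃ N : ℕ, ∀ x u, σ x ≤ Δ → Admissible f Uad x u → seqCost f ℓ x u ≤ M →
      ∃ j ≤ N, σ (trajectory f x u j) ≤ η := by
  obtain ⟨W, αW, χW, αWbar, -, hαW, hχW, -, hmono, -, hW⟩ := hdet
  have hc : (0 : ℝ) < αW η := by
    have := hαW.2.1 hη
    rw [hαW.2.2.1] at this
    exact this
  -- Half of the decrease `αW η` absorbs the constant term; the linear terms sum to at most `L * M`.
  -- Staying above `η` for `N` steps would make `W` negative.
  obtain ⟨L, hL, hχ⟩ := hχW.exists_affine_bound (half_pos hc) M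
  obtain ⟨N, hN⟩ := exists_nat_gt ((αWbar Δ + L * M) / ((αW η : ℝ) / 2))
  refine ⟨N, fun x u hx hu hcost => ?_⟩
  by_contra! hcon
  have hsumE : ∀ n, ∑ k ∈ Finset.range n, ℓ (trajectory f x u k, u k) ≤ M := by
    intro n
    have : (∑ k ∈ Finset.range n, (ℓ (trajectory f x u k, u k) : ℝ≥0∞)) ≤ M :=
      (ENNReal.sum_le_tsum _).trans hcost
    exact_mod_cast this
  have hℓM : ∀ k, ℓ (trajectory f x u k, u k) ≤ M := fun k =>
    (Finset.single_le_sum (f := fun k => ℓ (trajectory f x u k, u k)) (fun _ _ => zero_le)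
      (Finset.self_mem_range_succ k)).trans (hsumE (k + 1))
  have key : ∀ n ≤ N, (W (trajectory f x u n) : ℝ) + n * ((αW η : ℝ) / 2) ≤
      W x + L * ∑ k ∈ Finset.range n, (ℓ (trajectory f x u k, u k) : ℝ) := by
    intro n hn
    induction n with
    | zero => simp [trajectory]
    | succ n ih =>
      have h1 := ih (by omega)
      have h2 := (hW _ _ (hu n)).2
      have h3 : (αW η : ℝ) ≤ αW (σ (trajectory f x u n)) :=
        hαW.2.1.monotone (hcon n (by omega)).le
      have h4 := hχ _ (hℓM n)
      rw [Finset.sum_range_succ, mul_add, trajectory]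
      push_cast
      linarith
  have h1 := key N le_rfl
  have h2 : (W x : ℝ) ≤ αWbar Δ := (hW x _ (hu 0)).1.trans (hmono hx)
  have h3 : L * ∑ k ∈ Finset.range N, (ℓ (trajectory f x u k, u k) : ℝ) ≤ L * M :=
    mul_le_mul_of_nonneg_left (by exact_mod_cast hsumE N) hL
  rw [div_lt_iff₀ (half_pos hc)] at hN
  have h4 : (0 : ℝ) ≤ W (trajectory f x u N) := NNReal.coe_nonneg _
  linarith

end Plant

end PIPlus

/-! ### The main theorem -/

theorem mainTheorem8 {nx nu : ℕ}
    (f : EuclideanSpace ℝ (Fin nx) × EuclideanSpace ℝ (Fin nu) → EuclideanSpace ℝ (Fin nx))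
    (ℓ : EuclideanSpace ℝ (Fin nx) × EuclideanSpace ℝ (Fin nu) → ℝ≥0)
    (Uad : EuclideanSpace ℝ (Fin nx) → Set (EuclideanSpace ℝ (Fin nu)))
    (σ : EuclideanSpace ℝ (Fin nx) → ℝ≥0)
    (h₀ : EuclideanSpace ℝ (Fin nx) → EuclideanSpace ℝ (Fin nu))
    -- standing assumptions
    (hUad : ∀ x, (Uad x).Nonempty)
    (hh₀ : h₀ ∈ PIPlus.selections Uad)
    (hσ : Continuous σ)
    (hwell : PIPlus.WellPosed f ℓ Uad)
    (hdetect : PIPlus.Detectable f ℓ Uad σ)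
    (hstab : PIPlus.Stabilizing f ℓ σ h₀)
    -- the feasibility assumption
    (hf : Continuous f) (hℓ : Continuous ℓ)
    (hlevel : PIPlus.LevelBounded ℓ Uad)
    (hosc : PIPlus.OuterSemicontinuous Uad)
    (hlsc : LowerSemicontinuous (PIPlus.policyCost f ℓ h₀))
    (hcompact : ∀ Δ : ℝ≥0, 0 < Δ → IsCompact {x | σ x ≤ Δ}) :
    -- all minima in the definition of the value functions are attained
    (∀ i x, (PIPlus.inputs f ℓ Uad h₀ (i + 1) x).Nonempty ∧
      ∃ h ∈ PIPlus.selections (PIPlus.regInputs f ℓ Uad h₀ (i + 1)),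
        PIPlus.policyCost f ℓ h x = PIPlus.value f ℓ Uad h₀ (i + 1) x) ∧
    -- the value functions are finite and not below the optimal one
    (∀ i x, PIPlus.optValue f ℓ Uad x ≤ PIPlus.value f ℓ Uad h₀ i x ∧
      PIPlus.value f ℓ Uad h₀ i x < ⊤) ∧
    -- monotonicity
    (∀ i x, PIPlus.value f ℓ Uad h₀ (i + 1) x ≤ PIPlus.value f ℓ Uad h₀ i x) ∧
    -- convergence, uniformly on compact sets
    (∀ K : Set (EuclideanSpace ℝ (Fin nx)), IsCompact K → ∀ δ : ℝ, 0 < δ →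
      ∃ iStar : ℕ, 0 < iStar ∧ ∀ x ∈ K, ∀ i ≥ iStar,
        (PIPlus.value f ℓ Uad h₀ i x).toReal - (PIPlus.optValue f ℓ Uad x).toReal ≤ δ) := by
  have hcl := hosc.isClosed_graph
  obtain ⟨αV, hαV, hV0⟩ := hstab
  have hb : Continuous fun x => αV (σ x) := hαV.1.comp hσ
  have step : ∀ V : EuclideanSpace ℝ (Fin nx) → ℝ≥0∞, LowerSemicontinuous V →
      PIPlus.Decreasing f ℓ Uad V → (∀ x, V x ≤ αV (σ x)) →
      (∀ x, (PIPlus.improve f ℓ Uad V x).Nonempty) ∧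
      LowerSemicontinuous
        (PIPlus.evaluate f ℓ (PIPlus.regularize (PIPlus.improve f ℓ Uad V))) ∧
      ∃ h ∈ PIPlus.selections (PIPlus.regularize (PIPlus.improve f ℓ Uad V)),
        h ∈ PIPlus.selections Uad ∧ PIPlus.policyCost f ℓ h =
          PIPlus.evaluate f ℓ (PIPlus.regularize (PIPlus.improve f ℓ Uad V)) := by
    intro V hVlsc hVdec hVb
    have hne : ∀ x, (PIPlus.improve f ℓ Uad V x).Nonempty := fun x =>
      PIPlus.improve_nonempty hf hℓ hlevel hcl hVlsc hVdec
        ((hVb x).trans_lt ENNReal.coe_lt_top).ne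
    obtain ⟨hl, h, hh, he⟩ := PIPlus.exists_selection_policyCost_eq_evaluate hf hℓ
      (fun x => (hne x).mono (PIPlus.subset_regularize _ x))
      (PIPlus.locallyInCompact_improve hlevel hVdec hb hVb).regularize
      (PIPlus.isClosed_graph_regularize _)
    exact ⟨hne, hl, h, hh,
      fun x => PIPlus.regularize_subset hcl (fun z u hu => hu.1) x (hh x), he⟩
  have bellman : ∀ V : EuclideanSpace ℝ (Fin nx) → ℝ≥0∞, LowerSemicontinuous V →
      PIPlus.Decreasing f ℓ Uad V → (∀ x, V x ≤ αV (σ x)) → ∀ x, ∀ u ∈ Uad x,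
      PIPlus.evaluate f ℓ (PIPlus.regularize (PIPlus.improve f ℓ Uad V)) x ≤
        ℓ (x, u) + V (f (x, u)) := fun V hVlsc hVdec hVb x u hu =>
    hVdec.evaluate_le (step V hVlsc hVdec hVb).1 (PIPlus.subset_regularize _) hu
  have mono : ∀ V : EuclideanSpace ℝ (Fin nx) → ℝ≥0∞, LowerSemicontinuous V →
      PIPlus.Decreasing f ℓ Uad V → (∀ x, V x ≤ αV (σ x)) → ∀ x,
      PIPlus.evaluate f ℓ (PIPlus.regularize (PIPlus.improve f ℓ Uad V)) x ≤ V x := by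
    intro V hVlsc hVdec hVb x
    obtain ⟨g, hg, hgV⟩ := hVdec
    exact (bellman V hVlsc ⟨g, hg, hgV⟩ hVb x _ (hg x)).trans (hgV x)
  have inv : ∀ i, LowerSemicontinuous (PIPlus.value f ℓ Uad h₀ i) ∧
      (∃ h ∈ PIPlus.selections Uad, PIPlus.policyCost f ℓ h = PIPlus.value f ℓ Uad h₀ i) ∧
      ∀ x, PIPlus.value f ℓ Uad h₀ i x ≤ αV (σ x) := by
    intro i
    induction i with
    | zero => exact ⟨hlsc, ⟨h₀, hh₀, rfl⟩, hV0⟩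
    | succ i ih =>
      obtain ⟨hl, ⟨h, hh, he⟩, hle⟩ := ih
      have hdec : PIPlus.Decreasing f ℓ Uad (PIPlus.value f ℓ Uad h₀ i) :=
        he ▸ PIPlus.decreasing_policyCost hh
      obtain ⟨-, hl', g, -, hg, hge⟩ := step _ hl hdec hle
      exact ⟨hl', ⟨g, hg, hge⟩, fun x => (mono _ hl hdec hle x).trans (hle x)⟩
  have hdec : ∀ i, PIPlus.Decreasing f ℓ Uad (PIPlus.value f ℓ Uad h₀ i) := by
    intro i
    obtain ⟨-, ⟨h, hh, he⟩, -⟩ := inv i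
    exact he ▸ PIPlus.decreasing_policyCost hh
  have hfin : ∀ i x, PIPlus.optValue f ℓ Uad x ≤ PIPlus.value f ℓ Uad h₀ i x ∧
      PIPlus.value f ℓ Uad h₀ i x < ⊤ := by
    intro i x
    obtain ⟨-, ⟨h, hh, he⟩, hle⟩ := inv i
    exact ⟨he ▸ PIPlus.optValue_le_policyCost hh x, (hle x).trans_lt ENNReal.coe_lt_top⟩
  have hmono : ∀ i x, PIPlus.value f ℓ Uad h₀ (i + 1) x ≤ PIPlus.value f ℓ Uad h₀ i x :=
    fun i x => mono _ (inv i).1 (hdec i) (inv i).2.2 x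
  refine ⟨fun i x => ?_, hfin, hmono, fun K hK δ hδ => ?_⟩
  · obtain ⟨hne, -, h, hh, -, he⟩ := step _ (inv i).1 (hdec i) (inv i).2.2
    exact ⟨hne x, h, hh, congrFun he x⟩
  · obtain ⟨Δ, hΔ⟩ := (hK.image hσ).bddAbove
    have hev : ∀ᶠ s in 𝓝 (0 : ℝ≥0), (αV s : ℝ) < δ :=
      (NNReal.continuous_coe.comp hαV.1).continuousAt.eventually_lt_const
        (by simpa [hαV.2.2.1] using hδ)
    obtain ⟨η, hηδ, hη⟩ := ((hev.filter_mono nhdsWithin_le_nhds).and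
      (self_mem_nhdsWithin (s := Set.Ioi (0 : ℝ≥0)))).exists
    obtain ⟨N, hN⟩ := hdetect.exists_time Δ (αV Δ) hη
    -- The time `j ≤ N` found below depends on `x`; monotonicity in the index removes this
    -- dependence. The `+ 1` only ensures positivity.
    refine ⟨N + 1, N.succ_pos, fun x hx i hi => ?_⟩
    have hσx : σ x ≤ Δ := hΔ ⟨x, hx, rfl⟩
    obtain ⟨u, hu, hopt, hlt⟩ := hwell x
    obtain ⟨j, hj, hσj⟩ := hN x u hσx hu (by
      rw [hopt]
      exact (hfin 0 x).1.trans ((hV0 x).trans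
        (ENNReal.coe_le_coe.2 (hαV.2.1.monotone hσx))))
    have h1 : PIPlus.value f ℓ Uad h₀ i x ≤ PIPlus.value f ℓ Uad h₀ j x :=
      antitone_nat_of_succ_le (f := PIPlus.value f ℓ Uad h₀) hmono (by omega) x
    have h2 := PIPlus.le_sum_add_of_bellman_le
      (fun i => bellman _ (inv i).1 (hdec i) (inv i).2.2) hu j 0
    simp only [zero_add] at h2
    have h3 : PIPlus.value f ℓ Uad h₀ i x ≤ PIPlus.optValue f ℓ Uad x + αV η := by
      refine h1.trans (h2.trans (add_le_add ?_ ?_))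
      · rw [← hopt]
        exact ENNReal.sum_le_tsum _
      · exact (hV0 _).trans (ENNReal.coe_le_coe.2 (hαV.2.1.monotone hσj))
    have h4 := ENNReal.toReal_mono (ENNReal.add_ne_top.2 ⟨hlt.ne, ENNReal.coe_ne_top⟩) h3
    rw [ENNReal.toReal_add hlt.ne ENNReal.coe_ne_top, ENNReal.coe_toReal] at h4
    linarith
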